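/- A smocking pattern in $\mathbb{E}^N$ is a finite or countable collection $\mathcal I$ of pairwise disjoint, connected, compact subsets of $\mathbb{E}^N$ (the stitches) for which there is a $\delta>0$ such that points in distinct stitches are at Euclidean distance at least $\delta$. Its smocking set is $S=\bigcup_{I\in\mathcal I} I$. The smocked space $X$ is obtained from $\mathbb{E}^N$ by identifying each stitch to a point; $\pi:\mathbb{E}^N\to X$ is the quotient map, and the metric is $$d(x,y)=\inf\Big\{|v-z_1|+\sum_{i=1}^{m-1}|z_i'-z_{i+1}|+|z_m'-w|\Big\},$$ the infimum over all $m\ge 0$, all $v\in\pi^{-1}(x)$, $w\in\pi^{-1}(y)$, and all $z_i,z_i'\in I_i\in\mathcal I$ with $I_i\ne I_{i+1}$ (for $m=0$ the length is $|v-w|$). The space is equipped with the measure $\mu=\pi_\#\mathcal L^N$ and the base point $\pi(0)$. Corollary. Let $\mathcal I_k$ ($k\in\mathbb N$) and $\mathcal I_\infty$ be smocking patterns in $\mathbb{E}^N$, with smocking sets $S_k,S_\infty$ and pointed smocked metric measure spaces $(X_k,d_k,\mu_k,x_k)$, $(X_\infty,d_\infty,\mu_\infty,x_\infty)$. Assume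 that $S_k\to S_\infty$ in the Hausdorff distance, either globally, that is $d_H(S_k,S_\infty)\to 0$, or locally, that is, for every $R>0$, $$d_H\Big(\bigcup\{I\in\mathcal I_k: I\cap\overline{B_R(0)}\neq\varnothing\},\ \bigcup\{I\in\mathcal I_\infty: I\cap\overline{B_R(0)}\neq\varnothing\}\Big)\to 0$$ (with $d_H(\varnothing,\varnothing)=0$ and $d_H(\varnothing,A)=\infty$ for $A\ne\varnothing$). Assume moreover that the smocking constants are locally uniformly bounded: for every $R>0$ there are $L_R<\infty$, $\delta_R>0$ and $K_R$ such that for all $k\ge K_R$ every stitch in $\mathcal I_k$ meeting $\overline{B_R(0)}$ has diameter at most $L_R$, and distinct such stitches are at distance at least $\delta_R$ from each other. Then $$(X_k,d_k,\mu_k,x_k)\xrightarrow{\mathrm{pmGH}}(X_\infty,d_\infty,\mu_\infty,x_\infty).$$ That is: balls have finite measure in all these spaces, and there are $R_k\to\infty$, $\varepsilon_k>0$ with $\varepsilon_k\to0$, and Borel maps $f_k:X_k\to X_\infty$ with $f_k(x_k)=x_\infty$ such that $|d_\infty(f_k(a),f_k(b))-d_k(a,b)|\le\varepsilon_k$ for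 all $a,b\in B_{R_k}(x_k)$, the ball $B_{R_k-\varepsilon_k}(x_\infty)$ is contained in the $\varepsilon_k$-neighbourhood of $f_k(B_{R_k}(x_k))$, and $$\int_{B_{R_k}(x_k)}\varphi\circ f_k\,d\mu_k\to\int_{X_\infty}\varphi\,d\mu_\infty$$ for every bounded continuous $\varphi:X_\infty\to\mathbb R$ with bounded support. -/

import Mathlib

open Filter Topology MeasureTheory

noncomputable section

/-- A smocking pattern in Euclidean space `𝔼ᴺ`: a finite or countable collection of pairwise
disjoint, connected (hence nonempty), compact sets, the stitches, with a positive separation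
factor: distinct stitches are at distance at least some `δ > 0` from each other. -/
structure SmockingPattern (N : ℕ) where
  stitches : Set (Set (EuclideanSpace ℝ (Fin N)))
  countable : stitches.Countable
  isConnected : ∀ I ∈ stitches, IsConnected I
  isCompact : ∀ I ∈ stitches, IsCompact I
  disjoint : stitches.PairwiseDisjoint id
  separated : ∃ δ : ℝ, 0 < δ ∧ ∀ I ∈ stitches, ∀ I' ∈ stitches, I ≠ I' →
    ∀ z ∈ I, ∀ z' ∈ I', δ ≤ dist z z'

namespace SmockingPattern

variable {N : ℕ} (P : SmockingPattern N)

/-- The smocking set: the union of all stitches. -/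
def smockingSet : Set (EuclideanSpace ℝ (Fin N)) := ⋃₀ P.stitches

/-- The stitches that meet the closed Euclidean ball of radius `R` about the origin. -/
def stitchesMeeting (R : ℝ) : Set (Set (EuclideanSpace ℝ (Fin N))) :=
  {I ∈ P.stitches | (I ∩ Metric.closedBall 0 R).Nonempty}

/-- Two points are identified when they are equal or lie in a common stitch. -/
def Rel (v w : EuclideanSpace ℝ (Fin N)) : Prop :=
  v = w ∨ ∃ I ∈ P.stitches, v ∈ I ∧ w ∈ I

theorem eq_of_mem {I I' : Set (EuclideanSpace ℝ (Fin N))} (hI : I ∈ P.stitches)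
    (hI' : I' ∈ P.stitches) {v : EuclideanSpace ℝ (Fin N)} (h : v ∈ I) (h' : v ∈ I') :
    I = I' := by
  by_contra hne
  exact Set.disjoint_left.1 (P.disjoint hI hI' hne) h h'

def setoid : Setoid (EuclideanSpace ℝ (Fin N)) where
  r := P.Rel
  iseqv :=
    { refl := fun _ => Or.inl rfl
      symm := by
        rintro v w (rfl | ⟨I, hI, hv, hw⟩)
        · exact Or.inl rfl
        · exact Or.inr ⟨I, hI, hw, hv⟩
      trans := by
        rintro u v w (rfl | ⟨I, hI, hu, hv⟩) (rfl | ⟨I', hI', hv', hw⟩)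
        · exact Or.inl rfl
        · exact Or.inr ⟨I', hI', hv', hw⟩
        · exact Or.inr ⟨I, hI, hu, hv⟩
        · obtain rfl := P.eq_of_mem hI hI' hv hv'
          exact Or.inr ⟨I, hI, hu, hw⟩ }

/-- The smocked space: Euclidean space with every stitch collapsed to a point. -/
def Space : Type := Quotient P.setoid

/-- The smocking map `π : 𝔼ᴺ → X`. -/
def proj (v : EuclideanSpace ℝ (Fin N)) : P.Space := Quotient.mk P.setoid v

theorem proj_eq_iff {v w : EuclideanSpace ℝ (Fin N)} : P.proj v = P.proj w ↔ P.Rel v w :=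
  Quotient.eq (r := P.setoid)

theorem exists_rep (x : P.Space) : ∃ v, P.proj v = x := Quotient.exists_rep x

/-- One passage through a stitch: the stitch, the point of entry, the point of exit. -/
abbrev Hop (N : ℕ) : Type :=
  Set (EuclideanSpace ℝ (Fin N)) × EuclideanSpace ℝ (Fin N) × EuclideanSpace ℝ (Fin N)

/-- The total length `|v - z₁| + ∑ |z'ᵢ - zᵢ₊₁| + |z'ₖ - w|` of the segments that lead from `v`
to `w` through the listed stitches. -/
def chainLength (w : EuclideanSpace ℝ (Fin N)) :
    EuclideanSpace ℝ (Fin N) → List (Hop N) → ℝ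
  | v, [] => dist v w
  | v, h :: l => dist v h.2.1 + chainLength w h.2.2 l

/-- A list of hops `(I_{jᵢ}, zᵢ, z'ᵢ)` with `zᵢ, z'ᵢ ∈ I_{jᵢ}` and `j₁ ≠ j₂ ≠ ⋯ ≠ jₖ`. -/
def IsHopChain (l : List (Hop N)) : Prop :=
  (∀ h ∈ l, h.1 ∈ P.stitches ∧ h.2.1 ∈ h.1 ∧ h.2.2 ∈ h.1) ∧
    l.IsChain (fun h h' => h.1 ≠ h'.1)

/-- The lengths of all chains from a lift of `x` to a lift of `y`. -/
def chainLengths (x y : P.Space) : Set ℝ :=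
  {ℓ | ∃ v w : EuclideanSpace ℝ (Fin N), P.proj v = x ∧ P.proj w = y ∧
    ∃ l : List (Hop N), P.IsHopChain l ∧ ℓ = chainLength w v l}

/-- The smocked distance. -/
def smockedDist (x y : P.Space) : ℝ := sInf (P.chainLengths x y)

theorem chainLength_nonneg (w : EuclideanSpace ℝ (Fin N)) (l : List (Hop N)) :
    ∀ v, 0 ≤ chainLength w v l := by
  induction l with
  | nil => intro v; exact dist_nonneg
  | cons h l ih => intro v; exact add_nonneg dist_nonneg (ih _)

theorem bddBelow_chainLengths (x y : P.Space) : BddBelow (P.chainLengths x y) := by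
  refine ⟨0, ?_⟩
  rintro ℓ ⟨v, w, -, -, l, -, rfl⟩
  exact chainLength_nonneg w l v

theorem chainLengths_nonempty (x y : P.Space) : (P.chainLengths x y).Nonempty := by
  obtain ⟨v, rfl⟩ := P.exists_rep x
  obtain ⟨w, rfl⟩ := P.exists_rep y
  exact ⟨_, v, w, rfl, rfl, [], ⟨by simp, by simp⟩, rfl⟩

theorem chainLength_le_dist_add (w : EuclideanSpace ℝ (Fin N)) (l : List (Hop N))
    (u v : EuclideanSpace ℝ (Fin N)) :
    chainLength w u l ≤ dist u v + chainLength w v l := by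
  cases l with
  | nil => exact dist_triangle u v w
  | cons h l =>
    have := dist_triangle u v h.2.1
    simp only [chainLength]; linarith

theorem chainLength_append (w u : EuclideanSpace ℝ (Fin N)) (l' : List (Hop N))
    (l : List (Hop N)) :
    ∀ v, chainLength w v (l ++ l') ≤ chainLength u v l + chainLength w u l' := by
  induction l with
  | nil => intro v; exact chainLength_le_dist_add w l' v u
  | cons h l ih =>
    intro v
    have := ih h.2.2
    simp only [List.cons_append, chainLength]; linarith

/-- Consecutive hops through the same stitch can be merged without increasing the length. -/
theorem exists_isHopChain (w : EuclideanSpace ℝ (Fin N)) (l : List (Hop N)) :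
    (∀ h ∈ l, h.1 ∈ P.stitches ∧ h.2.1 ∈ h.1 ∧ h.2.2 ∈ h.1) → ∀ v,
      ∃ l', P.IsHopChain l' ∧ chainLength w v l' ≤ chainLength w v l := by
  induction l with
  | nil => intro _ v; exact ⟨[], ⟨by simp, by simp⟩, le_rfl⟩
  | cons h l ih =>
    intro hl v
    obtain ⟨l', hl', hle⟩ := ih (fun g hg => hl g (List.mem_cons_of_mem _ hg)) h.2.2
    have hh := hl h (by simp)
    cases l' with
    | nil =>
      refine ⟨[h], ⟨by simpa using hh, by simp⟩, ?_⟩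
      simp only [chainLength] at hle ⊢; linarith
    | cons g l'' =>
      obtain ⟨h1, h2⟩ := hl'
      by_cases hg : h.1 = g.1
      · refine ⟨(g.1, h.2.1, g.2.2) :: l'', ⟨?_, ?_⟩, ?_⟩
        · intro a ha
          rcases List.mem_cons.1 ha with rfl | ha
          · have := h1 g (by simp)
            exact ⟨this.1, hg ▸ hh.2.1, this.2.2⟩
          · exact h1 a (List.mem_cons_of_mem _ ha)
        · cases l'' with
          | nil => simp
          | cons b l3 => simpa using h2
        · have : (0 : ℝ) ≤ dist h.2.2 g.2.1 := dist_nonneg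
          simp only [chainLength] at hle ⊢; linarith
      · refine ⟨h :: g :: l'', ⟨?_, ?_⟩, ?_⟩
        · intro a ha
          rcases List.mem_cons.1 ha with rfl | ha
          · exact hh
          · exact h1 a ha
        · simpa using ⟨hg, by simpa using h2⟩
        · simp only [chainLength] at hle ⊢; linarith

theorem smockedDist_le (v w : EuclideanSpace ℝ (Fin N)) (l : List (Hop N))
    (hl : ∀ h ∈ l, h.1 ∈ P.stitches ∧ h.2.1 ∈ h.1 ∧ h.2.2 ∈ h.1) :
    P.smockedDist (P.proj v) (P.proj w) ≤ chainLength w v l := by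
  obtain ⟨l', hl', hle⟩ := P.exists_isHopChain w l hl v
  exact (csInf_le (P.bddBelow_chainLengths _ _) ⟨v, w, rfl, rfl, l', hl', rfl⟩).trans hle

theorem smockedDist_nonneg (x y : P.Space) : 0 ≤ P.smockedDist x y := by
  refine le_csInf (P.chainLengths_nonempty x y) ?_
  rintro ℓ ⟨v, w, -, -, l, -, rfl⟩
  exact chainLength_nonneg w l v

theorem smockedDist_self (x : P.Space) : P.smockedDist x x = 0 := by
  obtain ⟨v, rfl⟩ := P.exists_rep x
  refine le_antisymm ?_ (P.smockedDist_nonneg _ _)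
  simpa [chainLength] using P.smockedDist_le v v [] (by simp)

/-- Traversing a chain backwards. -/
def revHops (l : List (Hop N)) : List (Hop N) := (l.map fun h => (h.1, h.2.2, h.2.1)).reverse

theorem chainLength_revHops (w : EuclideanSpace ℝ (Fin N)) (l : List (Hop N)) :
    ∀ v, chainLength v w (revHops l) ≤ chainLength w v l := by
  induction l with
  | nil => intro v; simp [revHops, chainLength, dist_comm]
  | cons h l ih =>
    intro v
    have e : revHops (h :: l) = revHops l ++ [(h.1, h.2.2, h.2.1)] := by simp [revHops]
    rw [e]
    have h1 := chainLength_append v h.2.2 [(h.1, h.2.2, h.2.1)] (revHops l) w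
    have h2 := ih h.2.2
    simp only [chainLength, dist_self, zero_add] at h1 ⊢
    rw [dist_comm v]; linarith

theorem smockedDist_comm_le (x y : P.Space) : P.smockedDist y x ≤ P.smockedDist x y := by
  refine le_csInf (P.chainLengths_nonempty x y) ?_
  rintro ℓ ⟨v, w, rfl, rfl, l, hl, rfl⟩
  refine (P.smockedDist_le w v (revHops l) ?_).trans (chainLength_revHops w l v)
  intro h hh
  simp only [revHops, List.mem_reverse, List.mem_map] at hh
  obtain ⟨g, hg, rfl⟩ := hh
  have := hl.1 g hg
  exact ⟨this.1, this.2.2, this.2.1⟩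

theorem smockedDist_triangle (x y z : P.Space) :
    P.smockedDist x z ≤ P.smockedDist x y + P.smockedDist y z := by
  rw [← sub_le_iff_le_add]
  refine le_csInf (P.chainLengths_nonempty x y) ?_
  rintro ℓ ⟨u, v, rfl, rfl, l, hl, rfl⟩
  rw [sub_le_comm]
  refine le_csInf (P.chainLengths_nonempty _ z) ?_
  rintro ℓ ⟨v', w, hv', rfl, l', hl', rfl⟩
  have hv := hv'.symm
  rw [sub_le_iff_le_add']
  rcases P.proj_eq_iff.1 hv with rfl | ⟨I, hI, h1, h2⟩
  · refine (P.smockedDist_le u w (l ++ l') ?_).trans (chainLength_append w v l' l u)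
    intro h hh
    rcases List.mem_append.1 hh with hh | hh
    · exact hl.1 h hh
    · exact hl'.1 h hh
  · have key := chainLength_append w v ((I, v, v') :: l') l u
    simp only [chainLength, dist_self, zero_add] at key
    refine (P.smockedDist_le u w (l ++ (I, v, v') :: l') ?_).trans key
    intro h hh
    rcases List.mem_append.1 hh with hh | hh
    · exact hl.1 h hh
    · rcases List.mem_cons.1 hh with rfl | hh
      · exact ⟨hI, h1, h2⟩
      · exact hl'.1 h hh

/-- A fibre of the smocking map is at positive distance from all the other stitches. -/
theorem exists_gap (v : EuclideanSpace ℝ (Fin N)) : ∃ c : ℝ, 0 < c ∧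
    ∀ I ∈ P.stitches, v ∉ I → ∀ z ∈ I, ∀ a, P.Rel a v → c ≤ dist a z := by
  obtain ⟨δ, hδ, hsep⟩ := P.separated
  by_cases hv : ∃ I₀ ∈ P.stitches, v ∈ I₀
  · obtain ⟨I₀, hI₀, hv₀⟩ := hv
    refine ⟨δ, hδ, fun I hI hvI z hz a ha => ?_⟩
    have ha₀ : a ∈ I₀ := by
      rcases ha with rfl | ⟨I₁, hI₁, h1, h2⟩
      · exact hv₀
      · exact P.eq_of_mem hI₁ hI₀ h2 hv₀ ▸ h1
    exact hsep I₀ hI₀ I hI (by rintro rfl; exact hvI hv₀) a ha₀ z hz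
  · push Not at hv
    have hrel : ∀ a, P.Rel a v → a = v := by
      rintro a (h | ⟨I, hI, -, h⟩)
      · exact h
      · exact (hv I hI h).elim
    by_cases hn : ∃ I₀ ∈ P.stitches, ∃ z₀ ∈ I₀, dist v z₀ < δ / 2
    · obtain ⟨I₀, hI₀, z₀, hz₀, hd⟩ := hn
      have hpos : 0 < Metric.infDist v I₀ :=
        ((P.isCompact I₀ hI₀).isClosed.notMem_iff_infDist_pos ⟨z₀, hz₀⟩).1 (hv I₀ hI₀)
      refine ⟨min (δ / 2) (Metric.infDist v I₀), lt_min (by positivity) hpos, ?_⟩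
      intro I hI _ z hz a ha
      obtain rfl := hrel a ha
      by_cases hII : I = I₀
      · subst hII
        exact (min_le_right _ _).trans (Metric.infDist_le_dist_of_mem hz)
      · refine (min_le_left _ _).trans ?_
        have h1 := hsep I hI I₀ hI₀ hII z hz z₀ hz₀
        have h2 := dist_triangle z a z₀
        rw [dist_comm z a] at h2
        linarith
    · push Not at hn
      refine ⟨δ / 2, by positivity, fun I hI _ z hz a ha => ?_⟩
      obtain rfl := hrel a ha
      exact hn I hI z hz

theorem eq_of_smockedDist_eq_zero {x y : P.Space} (h0 : P.smockedDist x y = 0) : x = y := by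
  by_contra hne
  obtain ⟨v, rfl⟩ := P.exists_rep x
  obtain ⟨w, rfl⟩ := P.exists_rep y
  obtain ⟨δ, hδ, hsep⟩ := P.separated
  obtain ⟨cv, hcv, hv⟩ := P.exists_gap v
  obtain ⟨cw, hcw, hw⟩ := P.exists_gap w
  have hvw : 0 < dist v w := dist_pos.2 (fun h => hne (h ▸ rfl))
  have hnot : ∀ I ∈ P.stitches, v ∈ I → w ∉ I := fun I hI h1 h2 =>
    hne (P.proj_eq_iff.2 (Or.inr ⟨I, hI, h1, h2⟩))
  have hlow : min (min cv cw) (min δ (dist v w)) ≤ P.smockedDist (P.proj v) (P.proj w) := by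
    refine le_csInf (P.chainLengths_nonempty _ _) ?_
    rintro ℓ ⟨v', w', hv', hw', l, hl, rfl⟩
    rw [P.proj_eq_iff] at hv' hw'
    cases l with
    | nil =>
      simp only [chainLength]
      rcases hv' with rfl | ⟨I, hI, h1, h2⟩
      · rcases hw' with rfl | ⟨I, hI, h1, h2⟩
        · exact (min_le_right _ _).trans (min_le_right _ _)
        · refine ((min_le_left _ _).trans (min_le_left _ _)).trans ?_
          exact hv I hI (fun h => hnot I hI h h2) w' h1 v' (Or.inl rfl)
      · refine ((min_le_left _ _).trans (min_le_right _ _)).trans ?_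
        rw [dist_comm]
        exact hw I hI (hnot I hI h2) v' h1 w' hw'
    | cons g l =>
      have hg := hl.1 g (by simp)
      simp only [chainLength]
      by_cases hvg : v ∈ g.1
      · have hnn : (0 : ℝ) ≤ dist v' g.2.1 := dist_nonneg
        cases l with
        | nil =>
          simp only [chainLength]
          have := hw g.1 hg.1 (hnot _ hg.1 hvg) g.2.2 hg.2.2 w' hw'
          rw [dist_comm] at this
          have h3 := (min_le_left (min cv cw) (min δ (dist v w))).trans (min_le_right _ _)
          linarith
        | cons b l =>
          simp only [chainLength]
          have hb := hl.1 b (by simp)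
          have hgb : g.1 ≠ b.1 := (List.isChain_cons_cons.1 hl.2).1
          have := hsep g.1 hg.1 b.1 hb.1 hgb g.2.2 hg.2.2 b.2.1 hb.2.1
          have h3 := (min_le_right (min cv cw) (min δ (dist v w))).trans (min_le_left _ _)
          have h4 := chainLength_nonneg w' l b.2.2
          linarith
      · have := hv g.1 hg.1 hvg g.2.1 hg.2.1 v' hv'
        have h3 := (min_le_left (min cv cw) (min δ (dist v w))).trans (min_le_left _ _)
        have h4 := chainLength_nonneg w' l g.2.2
        linarith
  rw [h0] at hlow
  exact absurd hlow (not_le.2 (lt_min (lt_min hcv hcw) (lt_min hδ hvw)))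

/-- The smocked space is a metric space for the smocked distance. -/
instance : MetricSpace P.Space where
  dist := P.smockedDist
  dist_self := P.smockedDist_self
  dist_comm x y := le_antisymm (P.smockedDist_comm_le y x) (P.smockedDist_comm_le x y)
  dist_triangle := P.smockedDist_triangle
  eq_of_dist_eq_zero := P.eq_of_smockedDist_eq_zero

instance : MeasurableSpace P.Space := borel P.Space

instance : BorelSpace P.Space := ⟨rfl⟩

theorem measurable_proj : Measurable P.proj := by
  have h : LipschitzWith 1 P.proj := LipschitzWith.of_dist_le_mul fun v w => by
    rw [NNReal.coe_one, one_mul]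
    exact P.smockedDist_le v w [] (by simp)
  exact h.continuous.measurable

/-- The measure of the smocked space: the pushforward of Lebesgue measure under the
(measurable) smocking map. -/
def measure : Measure P.Space := Measure.map P.proj volume

/-- The base point of the smocked space: the image of the origin. -/
def basePoint : P.Space := P.proj 0

end SmockingPattern

/-- Pointed measured Gromov-Hausdorff convergence of pointed metric measure spaces
`(X k, μ k, x k)` whose balls have finite measure to such a space `(Y, ν, y)`. There are radii
`R k → ∞`, errors `ε k → 0` and Borel maps `f k`, considered on the balls `B(x k, R k)`, that
preserve the base points, distort distances by at most `ε k`, have images that are `ε k`-dense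
in `B(y, R k - ε k)`, and for which the pushforwards of the measures `μ k` restricted to
`B(x k, R k)` converge to `ν` when tested against the bounded continuous functions with bounded
support. -/
def PointedMeasuredGHTendsto {X : ℕ → Type*} [∀ k, MetricSpace (X k)]
    [∀ k, MeasurableSpace (X k)] (μ : ∀ k, Measure (X k)) (x : ∀ k, X k)
    {Y : Type*} [MetricSpace Y] [MeasurableSpace Y] (ν : Measure Y) (y : Y) : Prop :=
  (∀ k r, μ k (Metric.ball (x k) r) < ⊤) ∧ (∀ r, ν (Metric.ball y r) < ⊤) ∧
  ∃ (R ε : ℕ → ℝ) (f : ∀ k, X k → Y),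
    Tendsto R atTop atTop ∧ (∀ k, 0 < ε k) ∧ Tendsto ε atTop (𝓝 0) ∧
    (∀ k, Measurable (f k)) ∧
    (∀ k, f k (x k) = y) ∧
    (∀ k, ∀ a ∈ Metric.ball (x k) (R k), ∀ b ∈ Metric.ball (x k) (R k),
      |dist (f k a) (f k b) - dist a b| ≤ ε k) ∧
    (∀ k, Metric.ball y (R k - ε k) ⊆
      Metric.thickening (ε k) (f k '' Metric.ball (x k) (R k))) ∧
    ∀ φ : Y → ℝ, Continuous φ → (∃ C, ∀ p, |φ p| ≤ C) →
      Bornology.IsBounded (Function.support φ) →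
      Tendsto (fun k => ∫ a in Metric.ball (x k) (R k), φ (f k a) ∂(μ k)) atTop
        (𝓝 (∫ p, φ p ∂ν))

/-- Convergence of the smocking sets in the Hausdorff distance of `𝔼ᴺ`. -/
def HausdorffTendsto {N : ℕ} (P : ℕ → SmockingPattern N) (Q : SmockingPattern N) : Prop :=
  Tendsto (fun k => Metric.hausdorffEDist (P k).smockingSet Q.smockingSet) atTop (𝓝 0)

/-- Local Hausdorff convergence: for every `R > 0` the unions of the stitches that meet the closed
ball of radius `R` converge in the Hausdorff distance. -/
def LocallyHausdorffTendsto {N : ℕ} (P : ℕ → SmockingPattern N) (Q : SmockingPattern N) : Prop :=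
  ∀ R : ℝ, 0 < R →
    Tendsto (fun k => Metric.hausdorffEDist (⋃₀ (P k).stitchesMeeting R) (⋃₀ Q.stitchesMeeting R))
      atTop (𝓝 0)

/-- Local uniform bounds on the smocking constants: for every `R > 0` there are `L < ∞` and
`δ > 0` such that for all large `k` the stitches that meet the closed ball of radius `R` have
diameter at most `L`, and distinct ones are at distance at least `δ` from each other. -/
def LocalUniformBounds {N : ℕ} (P : ℕ → SmockingPattern N) : Prop :=
  ∀ R : ℝ, 0 < R → ∃ L δ : ℝ, 0 < δ ∧ ∃ K : ℕ, ∀ k ≥ K,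
    (∀ I ∈ (P k).stitchesMeeting R, Metric.diam I ≤ L) ∧
    ∀ I ∈ (P k).stitchesMeeting R, ∀ I' ∈ (P k).stitchesMeeting R, I ≠ I' →
      ∀ z ∈ I, ∀ z' ∈ I', δ ≤ dist z z'

end

/-! The approximations are `π_∞ ∘ s_k`, with `s_k` a Borel section of `π_k`. Everything rests on one
estimate: on a fixed ball of `𝔼ᴺ`, the smocked distances of two patterns, pulled back by the
smocking maps, eventually differ by at most `η`. `StitchesNear.dist_proj_le_add` is the one-sided
form. It is stated for two sequences of patterns, so that it serves in both directions, with the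
limit as a constant sequence.

For the estimate, a nearly minimal chain of one pattern is rerouted through the other. By
connectedness each stitch lies close to a single stitch of the other pattern
(`PointsNear.stitchesNear`), so each hop costs at most `2ε`. The number of hops must then be
bounded, and the chain must stay in a bounded region. Hops have no length, and how far one reaches
is controlled only in terms of where it starts, so hops have to be counted with a separation
constant that does not depend on the region. The hypothesis gives only `δ_R`, which may tend to `0`
as `R` grows; but the limit has a global `δ`, and closeness hands `δ / 2` back to the approximating
patterns (`LocallySeparated.eventuallySeparated`). This yields `exists_hops_bound`.

Distortion and density follow directly. Integrals are pulled back to Lebesgue measure on `𝔼ᴺ`, where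
dominated convergence applies. A diagonal choice then lets the radii grow. -/

namespace SmockingPattern

variable {N : ℕ}

/-- Stitches that meet a fixed ball eventually lie in a common larger ball. -/
def EventuallyBounded (A : ℕ → SmockingPattern N) : Prop :=
  ∀ R : ℝ, ∃ L : ℝ, ∀ᶠ k in atTop, ∀ I ∈ (A k).stitchesMeeting R, I ⊆ Metric.closedBall 0 L

/-- Distinct stitches that meet a fixed ball are eventually at distance at least `δ`. -/
def EventuallySeparated (A : ℕ → SmockingPattern N) (δ : ℝ) : Prop :=
  ∀ R : ℝ, ∀ᶠ k in atTop, ∀ I ∈ (A k).stitchesMeeting R, ∀ I' ∈ (A k).stitchesMeeting R,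
    I ≠ I' → ∀ z ∈ I, ∀ z' ∈ I', δ ≤ dist z z'

/-- Distinct stitches that meet a fixed ball are eventually at a distance bounded below by a
positive constant, which may depend on the ball. -/
def LocallySeparated (A : ℕ → SmockingPattern N) : Prop :=
  ∀ R : ℝ, ∃ δ : ℝ, 0 < δ ∧ ∀ᶠ k in atTop, ∀ I ∈ (A k).stitchesMeeting R,
    ∀ I' ∈ (A k).stitchesMeeting R, I ≠ I' → ∀ z ∈ I, ∀ z' ∈ I', δ ≤ dist z z'

/-- Within each ball, the smocking sets of `A` eventually lie close to those of `B`. -/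
def PointsNear (A B : ℕ → SmockingPattern N) : Prop :=
  ∀ R ε : ℝ, 0 < ε → ∀ᶠ k in atTop, ∀ z ∈ (A k).smockingSet, z ∈ Metric.closedBall 0 R →
    ∃ z' ∈ (B k).smockingSet, dist z z' < ε

/-- Each stitch of `A` that meets a fixed ball eventually lies close to a single stitch of `B`. -/
def StitchesNear (A B : ℕ → SmockingPattern N) : Prop :=
  ∀ R ε : ℝ, 0 < ε → ∀ᶠ k in atTop, ∀ I ∈ (A k).stitchesMeeting R,
    ∃ J ∈ (B k).stitches, I ⊆ Metric.thickening ε J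

theorem mem_stitchesMeeting_of_norm_le {P : SmockingPattern N}
    {I : Set (EuclideanSpace ℝ (Fin N))} {z : EuclideanSpace ℝ (Fin N)} {R : ℝ}
    (hI : I ∈ P.stitches) (hz : z ∈ I) (hR : ‖z‖ ≤ R) : I ∈ P.stitchesMeeting R :=
  ⟨hI, z, hz, by simpa using hR⟩

theorem norm_le_of_dist_le {v w : EuclideanSpace ℝ (Fin N)} {R r : ℝ} (hv : ‖v‖ ≤ R)
    (h : dist v w ≤ r) : ‖w‖ ≤ R + r := by
  have h1 := norm_le_norm_add_norm_sub' w v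
  rw [dist_eq_norm, norm_sub_rev] at h
  linarith

/-! ### Stitches of a single pattern -/

/-- A ball of radius `δ / 2` meets at most one stitch. By compactness only finitely many stitches
meet the given ball, and each of them is bounded. -/
theorem exists_stitches_bound (P : SmockingPattern N) (R : ℝ) :
    ∃ L : ℝ, ∀ I ∈ P.stitchesMeeting R, I ⊆ Metric.closedBall 0 L := by
  obtain ⟨δ, hδ, hsep⟩ := P.separated
  obtain ⟨t, -, ht, hcov⟩ :=
    (isCompact_closedBall (0 : EuclideanSpace ℝ (Fin N)) R).finite_cover_balls (half_pos hδ)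
  have hloc : ∀ c, Bornology.IsBounded
      (⋃₀ {I ∈ P.stitches | (I ∩ Metric.ball c (δ / 2)).Nonempty}) := by
    intro c
    have hsub : {I ∈ P.stitches | (I ∩ Metric.ball c (δ / 2)).Nonempty}.Subsingleton := by
      rintro I ⟨hI, z, hz, hzc⟩ I' ⟨hI', z', hz', hzc'⟩
      by_contra hne
      have h1 := hsep I hI I' hI' hne z hz z' hz'
      have h2 := dist_triangle_right z z' c
      rw [Metric.mem_ball] at hzc hzc'
      linarith
    exact (Bornology.isBounded_sUnion hsub.finite).2 fun I hI => (P.isCompact I hI.1).isBounded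
  have hb : Bornology.IsBounded
      (⋃ c ∈ t, ⋃₀ {I ∈ P.stitches | (I ∩ Metric.ball c (δ / 2)).Nonempty}) :=
    (Bornology.isBounded_biUnion ht).2 fun c _ => hloc c
  obtain ⟨L, hL⟩ := hb.subset_closedBall 0
  refine ⟨L, fun I hI z hz => hL ?_⟩
  obtain ⟨hI, y, hy, hyR⟩ := hI
  obtain ⟨c, hc, hyc⟩ := Set.mem_iUnion₂.1 (hcov hyR)
  exact Set.mem_biUnion hc ⟨I, ⟨hI, y, hy, hyc⟩, hz⟩

theorem eventuallyBounded_const (P : SmockingPattern N) : EventuallyBounded fun _ => P :=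
  fun R => (P.exists_stitches_bound R).imp fun _ h => Eventually.of_forall fun _ => h

theorem exists_eventuallySeparated_const (P : SmockingPattern N) :
    ∃ δ, 0 < δ ∧ EventuallySeparated (fun _ => P) δ := by
  obtain ⟨δ, hδ, hsep⟩ := P.separated
  exact ⟨δ, hδ, fun _ => Eventually.of_forall fun _ I hI I' hI' => hsep I hI.1 I' hI'.1⟩

theorem EventuallySeparated.locallySeparated {A : ℕ → SmockingPattern N} {δ : ℝ} (hδ : 0 < δ)
    (h : EventuallySeparated A δ) : LocallySeparated A := fun R => ⟨δ, hδ, h R⟩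

/-! ### Matching the stitches of two sequences of patterns -/

/-- A stitch of `A` is covered by the open `η`-thickenings of stitches of `B`. Since `2η ≤ δ` these
are pairwise disjoint, so a connected set lies in just one of them. -/
theorem PointsNear.stitchesNear {A B : ℕ → SmockingPattern N} (h : PointsNear A B)
    (hA : EventuallyBounded A) (hB : LocallySeparated B) : StitchesNear A B := by
  intro R ε hε
  obtain ⟨L, hL⟩ := hA R
  obtain ⟨δ, hδ, hsep⟩ := hB (L + 1)
  set η := min ε (min 1 (δ / 2)) with hη
  have hη0 : 0 < η := by positivity
  have hηε : η ≤ ε := min_le_left _ _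
  have hη1 : η ≤ 1 := (min_le_right _ _).trans (min_le_left _ _)
  have hηδ : η ≤ δ / 2 := (min_le_right _ _).trans (min_le_right _ _)
  filter_upwards [hL, hsep, h L η hη0] with k hL hsep hnear I hI
  have hIL := hL I hI
  have key : ∀ z ∈ I, ∃ J ∈ (B k).stitchesMeeting (L + 1), z ∈ Metric.thickening η J := by
    intro z hz
    obtain ⟨z', ⟨J, hJ, hz'⟩, hd⟩ := hnear z ⟨I, hI.1, hz⟩ (hIL hz)
    refine ⟨J, mem_stitchesMeeting_of_norm_le hJ hz' ?_, Metric.mem_thickening_iff.2 ⟨z', hz', hd⟩⟩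
    have := norm_le_of_dist_le (by simpa using hIL hz) hd.le
    linarith
  obtain ⟨z₀, hz₀⟩ := ((A k).isConnected I hI.1).nonempty
  obtain ⟨J, hJ, hzJ⟩ := key z₀ hz₀
  refine ⟨J, hJ.1, Set.Subset.trans ?_ (Metric.thickening_mono hηε J)⟩
  -- The separation is between the thickening of `J` and the union of all the others.
  refine ((A k).isConnected I hI.1).isPreconnected.subset_left_of_subset_union
    (v := ⋃ J' ∈ {J' ∈ (B k).stitchesMeeting (L + 1) | J' ≠ J}, Metric.thickening η J')
    Metric.isOpen_thickening (isOpen_biUnion fun _ _ => Metric.isOpen_thickening) ?_ ?_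
    ⟨z₀, hz₀, hzJ⟩
  · refine Set.disjoint_iUnion₂_right.2 fun J' hJ' => Set.disjoint_left.2 fun z h1 h2 => ?_
    obtain ⟨y, hy, hzy⟩ := Metric.mem_thickening_iff.1 h1
    obtain ⟨y', hy', hzy'⟩ := Metric.mem_thickening_iff.1 h2
    have h3 := hsep J hJ J' hJ'.1 hJ'.2.symm y hy y' hy'
    have h4 := dist_triangle_left y y' z
    linarith
  · intro z hz
    obtain ⟨J', hJ', hzJ'⟩ := key z hz
    by_cases hne : J' = J
    · exact Or.inl (hne ▸ hzJ')
    · exact Or.inr (Set.mem_biUnion (show J' ∈ {J' ∈ _ | J' ≠ J} from ⟨hJ', hne⟩) hzJ')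

/-- Local separation becomes uniform for patterns that are close to a separated pattern. -/
theorem LocallySeparated.eventuallySeparated {A B : ℕ → SmockingPattern N}
    (hA : LocallySeparated A) (hAB : StitchesNear A B) (hBA : StitchesNear B A)
    (hAb : EventuallyBounded A) {δ : ℝ} (hδ : 0 < δ) (hB : EventuallySeparated B δ) :
    EventuallySeparated A (δ / 2) := by
  intro R
  -- The argument goes from a point of norm at most `R` to a stitch of `B` and back to `A`, two
  -- moves of length below `η ≤ 1`.
  obtain ⟨δ', hδ', hsep'⟩ := hA (R + 1 + 1)
  obtain ⟨L, hL⟩ := hAb R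
  set η := min (δ / 4) (min 1 (δ' / 2)) with hη
  have hη0 : 0 < η := by positivity
  have hηδ : η ≤ δ / 4 := min_le_left _ _
  have hη1 : η ≤ 1 := (min_le_right _ _).trans (min_le_left _ _)
  have hηδ' : η ≤ δ' / 2 := (min_le_right _ _).trans (min_le_right _ _)
  filter_upwards [hsep', hAB R η hη0, hBA (R + 1) η hη0, hB (L + 1), hL] with
    k hsep' hAB hBA hB hL I hI I' hI' hne z hz z' hz'
  obtain ⟨J, hJ, hIJ⟩ := hAB I hI
  obtain ⟨J', hJ', hIJ'⟩ := hAB I' hI'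
  obtain ⟨y, hy, hzy⟩ := Metric.mem_thickening_iff.1 (hIJ hz)
  obtain ⟨y', hy', hzy'⟩ := Metric.mem_thickening_iff.1 (hIJ' hz')
  by_cases hJJ : J = J'
  · subst hJJ
    exfalso
    -- If both stitches are close to the same `J`, then `J` is itself close to one stitch `I₀` of
    -- `A`. Each of the two is then within `2η ≤ δ'` of `I₀`, hence equal to it.
    have huniq : ∃ I₀, ∀ I ∈ (A k).stitchesMeeting R, I ⊆ Metric.thickening η J → I = I₀ := by
      have hJR : J ∈ (B k).stitchesMeeting (R + 1) := by
        obtain ⟨-, x, hx, hxR⟩ := hI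
        obtain ⟨u, hu, hxu⟩ := Metric.mem_thickening_iff.1 (hIJ hx)
        refine mem_stitchesMeeting_of_norm_le hJ hu ?_
        have := norm_le_of_dist_le (by simpa using hxR) hxu.le
        linarith
      obtain ⟨I₀, hI₀, hJI⟩ := hBA J hJR
      refine ⟨I₀, fun I hI hIJ => ?_⟩
      by_contra hne
      obtain ⟨hI, x, hx, hxR⟩ := hI
      obtain ⟨u, hu, hxu⟩ := Metric.mem_thickening_iff.1 (hIJ hx)
      obtain ⟨s, hs, hus⟩ := Metric.mem_thickening_iff.1 (hJI hu)
      have hxR : ‖x‖ ≤ R := by simpa using hxR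
      have huR := norm_le_of_dist_le hxR hxu.le
      have hsR := norm_le_of_dist_le huR hus.le
      have h1 := hsep' I (mem_stitchesMeeting_of_norm_le hI hx (by linarith)) I₀
        (mem_stitchesMeeting_of_norm_le hI₀ hs (by linarith)) hne x hx s hs
      have h2 := dist_triangle x u s
      linarith
    obtain ⟨I₀, h0⟩ := huniq
    exact hne ((h0 I hI hIJ).trans (h0 I' hI' hIJ').symm)
  · have hyL := norm_le_of_dist_le (by simpa using hL I hI hz) hzy.le
    have hyL' := norm_le_of_dist_le (by simpa using hL I' hI' hz') hzy'.le
    have h1 := hB J (mem_stitchesMeeting_of_norm_le hJ hy (by linarith)) J'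
      (mem_stitchesMeeting_of_norm_le hJ' hy' (by linarith)) hJJ y hy y' hy'
    have h2 := dist_triangle4 y z z' y'
    rw [dist_comm y z] at h2
    linarith

/-! ### Chains of bounded length stay in a bounded region -/

/-- The infimum runs over all lifts. Prescribed lifts are reached at no cost by an extra hop inside
the end stitches, and merging restores the condition on consecutive stitches. -/
theorem exists_chain_lt (P : SmockingPattern N) (v w : EuclideanSpace ℝ (Fin N)) {r : ℝ}
    (hr : dist (P.proj v) (P.proj w) < r) :
    ∃ l, P.IsHopChain l ∧ chainLength w v l < r := by
  obtain ⟨ℓ, ⟨v', w', hv', hw', l, hl, rfl⟩, hlt⟩ :=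
    exists_lt_of_csInf_lt (P.chainLengths_nonempty _ _) hr
  have hstart : ∃ l₁ : List (Hop N),
      (∀ h ∈ l₁, h.1 ∈ P.stitches ∧ h.2.1 ∈ h.1 ∧ h.2.2 ∈ h.1) ∧
        chainLength w' v l₁ ≤ chainLength w' v' l := by
    rcases P.proj_eq_iff.1 hv' with rfl | ⟨I, hI, h1, h2⟩
    · exact ⟨l, hl.1, le_rfl⟩
    · refine ⟨(I, v, v') :: l, ?_, by simp [chainLength]⟩
      intro h hh
      rcases List.mem_cons.1 hh with rfl | hh
      exacts [⟨hI, h2, h1⟩, hl.1 h hh]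
  obtain ⟨l₁, hl₁, hle₁⟩ := hstart
  have hend : ∃ l₂ : List (Hop N),
      (∀ h ∈ l₂, h.1 ∈ P.stitches ∧ h.2.1 ∈ h.1 ∧ h.2.2 ∈ h.1) ∧
        chainLength w v l₂ ≤ chainLength w' v l₁ := by
    rcases P.proj_eq_iff.1 hw' with rfl | ⟨I, hI, h1, h2⟩
    · exact ⟨l₁, hl₁, le_rfl⟩
    · refine ⟨l₁ ++ [(I, w', w)], ?_, ?_⟩
      · intro h hh
        rcases List.mem_append.1 hh with hh | hh
        · exact hl₁ h hh
        · rw [List.mem_singleton] at hh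
          subst hh
          exact ⟨hI, h1, h2⟩
      · simpa [chainLength] using chainLength_append w w' [(I, w', w)] l₁ v
  obtain ⟨l₂, hl₂, hle₂⟩ := hend
  obtain ⟨l₃, hl₃, hle₃⟩ := P.exists_isHopChain w l₂ hl₂ v
  exact ⟨l₃, hl₃, by linarith⟩

/-- Each gap between consecutive hops uses up at least `δ` of the length, which drives the
induction. The bound `R'` comes from iterating the reach `L` of a stitch `n` times, so `δ` must be
fixed before `R`. -/
theorem exists_hops_bound_of_cons {A : ℕ → SmockingPattern N} (hb : EventuallyBounded A) {δ : ℝ}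
    (hs : EventuallySeparated A δ) (n : ℕ) :
    ∀ R : ℝ, ∃ R' : ℝ, ∀ᶠ k in atTop, ∀ h l w, (A k).IsHopChain (h :: l) → ‖h.2.1‖ ≤ R →
      chainLength w h.2.2 l < n * δ →
        (h :: l).length ≤ n ∧ (∀ g ∈ h :: l, ‖g.2.1‖ ≤ R') ∧ ‖w‖ ≤ R' := by
  induction n with
  | zero =>
    refine fun R => ⟨0, Eventually.of_forall fun k h l w _ _ hlt => ?_⟩
    have := chainLength_nonneg w l h.2.2
    simp only [Nat.cast_zero, zero_mul] at hlt
    linarith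
  | succ n ih =>
    intro R
    obtain ⟨L, hL⟩ := hb R
    -- The first stitch is left at norm at most `L`, and less than `(n + 1) * δ` of length remains.
    obtain ⟨R₁, hR₁⟩ := ih (L + (n + 1 : ℕ) * δ)
    refine ⟨max R (max (L + (n + 1 : ℕ) * δ) R₁), ?_⟩
    filter_upwards [hL, hR₁, hs (max R (L + (n + 1 : ℕ) * δ))] with k hL hR₁ hs h l w hl hh hlt
    obtain ⟨hI, hz, hz'⟩ := hl.1 h (by simp)
    have hzL : ‖h.2.2‖ ≤ L := by
      simpa using hL h.1 (mem_stitchesMeeting_of_norm_le hI hz hh) hz'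
    cases l with
    | nil =>
      simp only [chainLength] at hlt
      refine ⟨by simp, ?_, ?_⟩
      · intro g hg
        rw [List.mem_singleton] at hg
        exact hg ▸ hh.trans (le_max_left _ _)
      · exact (norm_le_of_dist_le hzL hlt.le).trans ((le_max_left _ _).trans (le_max_right _ _))
    | cons g l =>
      obtain ⟨hJ, hy, hy'⟩ := hl.1 g (by simp)
      obtain ⟨hne, hchain⟩ := List.isChain_cons_cons.1 hl.2
      simp only [chainLength] at hlt
      have hnn := chainLength_nonneg w l g.2.2
      have hyR : ‖g.2.1‖ ≤ L + (n + 1 : ℕ) * δ := norm_le_of_dist_le hzL (by linarith)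
      have hgap := hs h.1 (mem_stitchesMeeting_of_norm_le hI hz (hh.trans (le_max_left _ _))) g.1
        (mem_stitchesMeeting_of_norm_le hJ hy (hyR.trans (le_max_right _ _))) hne h.2.2 hz'
        g.2.1 hy
      obtain ⟨h1, h2, h3⟩ := hR₁ g l w ⟨fun a ha => hl.1 a (List.mem_cons_of_mem _ ha), hchain⟩
        hyR (by push_cast at hlt; linarith)
      refine ⟨by simpa using h1, ?_, h3.trans ((le_max_right _ _).trans (le_max_right _ _))⟩
      intro a ha
      rcases List.mem_cons.1 ha with rfl | ha
      · exact hh.trans (le_max_left _ _)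
      · exact (h2 a ha).trans ((le_max_right _ _).trans (le_max_right _ _))

/-- Chains of bounded length that start in a bounded region have boundedly many hops and stay in a
bounded region, uniformly for all large `k`. -/
theorem exists_hops_bound {A : ℕ → SmockingPattern N} (hb : EventuallyBounded A) {δ : ℝ}
    (hδ : 0 < δ) (hs : EventuallySeparated A δ) (R T : ℝ) :
    ∃ (n : ℕ) (R' : ℝ), ∀ᶠ k in atTop, ∀ l v w, (A k).IsHopChain l → ‖v‖ ≤ R →
      chainLength w v l < T → l.length ≤ n ∧ (∀ g ∈ l, ‖g.2.1‖ ≤ R') ∧ ‖w‖ ≤ R' := by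
  obtain ⟨n, hn⟩ := exists_nat_ge (T / δ)
  rw [div_le_iff₀ hδ] at hn
  obtain ⟨R', hR'⟩ := exists_hops_bound_of_cons hb hs n (R + T)
  refine ⟨n, max (R + T) R', ?_⟩
  filter_upwards [hR'] with k hR' l v w hl hv hlt
  cases l with
  | nil => exact ⟨by simp, by simp, (norm_le_of_dist_le hv hlt.le).trans (le_max_left _ _)⟩
  | cons h l =>
    simp only [chainLength] at hlt
    have h1 := chainLength_nonneg w l h.2.2
    have h2 : (0 : ℝ) ≤ dist v h.2.1 := dist_nonneg
    obtain ⟨h3, h4, h5⟩ := hR' h l w hl (norm_le_of_dist_le hv (by linarith)) (by linarith)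
    exact ⟨h3, fun g hg => (h4 g hg).trans (le_max_right _ _), h5.trans (le_max_right _ _)⟩

/-- Lifts of balls about the base point are bounded, uniformly for all large `k`. -/
theorem exists_norm_le_of_dist_lt {A : ℕ → SmockingPattern N} (hb : EventuallyBounded A) {δ : ℝ}
    (hδ : 0 < δ) (hs : EventuallySeparated A δ) (r : ℝ) :
    ∃ R' : ℝ, ∀ᶠ k in atTop, ∀ w, dist ((A k).proj w) (A k).basePoint < r → ‖w‖ ≤ R' := by
  obtain ⟨n, R', hR'⟩ := exists_hops_bound hb hδ hs 0 r
  refine ⟨R', ?_⟩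
  filter_upwards [hR'] with k hR' w hw
  rw [dist_comm] at hw
  obtain ⟨l, hl, hlt⟩ := (A k).exists_chain_lt 0 w hw
  exact (hR' l 0 w hl (by simp) hlt).2.2

theorem measure_ball_lt_top (P : SmockingPattern N) (r : ℝ) :
    P.measure (Metric.ball P.basePoint r) < ⊤ := by
  obtain ⟨δ, hδ, hs⟩ := P.exists_eventuallySeparated_const
  obtain ⟨R', hR'⟩ := exists_norm_le_of_dist_lt P.eventuallyBounded_const hδ hs r
  obtain ⟨-, hR'⟩ := hR'.exists
  rw [measure, Measure.map_apply P.measurable_proj Metric.isOpen_ball.measurableSet]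
  refine (measure_mono fun w hw => ?_).trans_lt
    (measure_closedBall_lt_top (x := (0 : EuclideanSpace ℝ (Fin N))) (r := R'))
  simpa using hR' w hw

/-! ### Comparison of the smocked distances -/

/-- Each stitch is replaced by a nearby `J`; moving the entry and exit points costs `ε` each. -/
theorem exists_chainLength_le_add (P : SmockingPattern N) {ε : ℝ}
    (w : EuclideanSpace ℝ (Fin N)) (l : List (Hop N)) :
    (∀ h ∈ l, h.2.1 ∈ h.1 ∧ h.2.2 ∈ h.1 ∧
      ∃ J ∈ P.stitches, h.1 ⊆ Metric.thickening ε J) → ∀ v,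
    ∃ l' : List (Hop N), (∀ h ∈ l', h.1 ∈ P.stitches ∧ h.2.1 ∈ h.1 ∧ h.2.2 ∈ h.1) ∧
      chainLength w v l' ≤ chainLength w v l + l.length * (2 * ε) := by
  induction l with
  | nil => intro _ v; exact ⟨[], by simp, by simp⟩
  | cons h l ih =>
    intro hl v
    obtain ⟨hz, hz', J, hJ, hsub⟩ := hl h (by simp)
    obtain ⟨y, hy, hzy⟩ := Metric.mem_thickening_iff.1 (hsub hz)
    obtain ⟨y', hy', hzy'⟩ := Metric.mem_thickening_iff.1 (hsub hz')
    obtain ⟨l', hl', hle⟩ := ih (fun g hg => hl g (List.mem_cons_of_mem _ hg)) h.2.2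
    refine ⟨(J, y, y') :: l', ?_, ?_⟩
    · intro g hg
      rcases List.mem_cons.1 hg with rfl | hg
      exacts [⟨hJ, hy, hy'⟩, hl' g hg]
    · have h1 := dist_triangle v h.2.1 y
      have h2 := chainLength_le_dist_add w l' y' h.2.2
      rw [dist_comm y'] at h2
      simp only [chainLength, List.length_cons]
      push_cast
      linarith

theorem dist_proj_le (P : SmockingPattern N) (v w : EuclideanSpace ℝ (Fin N)) :
    dist (P.proj v) (P.proj w) ≤ dist v w := P.smockedDist_le v w [] (by simp)

theorem StitchesNear.dist_proj_le_add {A B : ℕ → SmockingPattern N} (h : StitchesNear A B)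
    (hb : EventuallyBounded A) {δ : ℝ} (hδ : 0 < δ) (hs : EventuallySeparated A δ)
    (R : ℝ) {η : ℝ} (hη : 0 < η) :
    ∀ᶠ k in atTop, ∀ v w, ‖v‖ ≤ R → ‖w‖ ≤ R →
      dist ((B k).proj v) ((B k).proj w) ≤ dist ((A k).proj v) ((A k).proj w) + η := by
  obtain ⟨n, R', hR'⟩ := exists_hops_bound hb hδ hs R (2 * R + η)
  -- At most `n` hops at `2ε` each cost at most `η / 2`; the other half of `η` pays for the chain
  -- not being minimal.
  have hε : 0 < η / (4 * (n + 1)) := by positivity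
  filter_upwards [hR', h R' _ hε] with k hR' hnear v w hv hw
  obtain ⟨l, hl, hlt⟩ := (A k).exists_chain_lt v w
    (r := dist ((A k).proj v) ((A k).proj w) + η / 2) (by linarith)
  have hvw := (A k).dist_proj_le v w
  have hvw' : dist v w ≤ 2 * R := by
    rw [dist_eq_norm]; linarith [norm_sub_le v w]
  obtain ⟨h1, h2, -⟩ := hR' l v w hl hv (by linarith)
  obtain ⟨l', hl', hle⟩ := (B k).exists_chainLength_le_add w l (fun g hg =>
    ⟨(hl.1 g hg).2.1, (hl.1 g hg).2.2, hnear g.1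
      (mem_stitchesMeeting_of_norm_le (hl.1 g hg).1 (hl.1 g hg).2.1 (h2 g hg))⟩) v
  have h3 : (l.length : ℝ) * (2 * (η / (4 * (n + 1)))) ≤ η / 2 := by
    have h4 : (l.length : ℝ) ≤ n := by exact_mod_cast h1
    calc (l.length : ℝ) * (2 * (η / (4 * (n + 1))))
        ≤ (n + 1) * (2 * (η / (4 * (n + 1)))) := by gcongr; linarith
      _ = η / 2 := by field_simp; ring
  have h5 : dist ((B k).proj v) ((B k).proj w) ≤ chainLength w v l' :=
    (B k).smockedDist_le v w l' hl'
  linarith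

/-! ### A Borel section of the smocking map -/

theorem measurableSet_smockingSet (P : SmockingPattern N) : MeasurableSet P.smockingSet :=
  MeasurableSet.sUnion P.countable fun I hI => (P.isCompact I hI).measurableSet

theorem continuous_proj (P : SmockingPattern N) : Continuous P.proj :=
  (LipschitzWith.of_dist_le_mul (K := 1) fun v w => by
    simpa using P.dist_proj_le v w).continuous

theorem countable_image_smockingSet (P : SmockingPattern N) :
    (P.proj '' P.smockingSet).Countable := by
  rw [smockingSet, Set.image_sUnion]
  refine (P.countable.image _).sUnion ?_
  rintro _ ⟨I, hI, rfl⟩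
  refine Set.Subsingleton.countable ?_
  rintro _ ⟨v, hv, rfl⟩ _ ⟨w, hw, rfl⟩
  exact P.proj_eq_iff.2 (Or.inr ⟨I, hI, hv, hw⟩)

theorem injOn_proj_compl (P : SmockingPattern N) : Set.InjOn P.proj P.smockingSetᶜ := by
  intro v hv w _ h
  rcases P.proj_eq_iff.1 h with h | ⟨I, hI, h1, -⟩
  · exact h
  · exact (hv ⟨I, hI, h1⟩).elim

/-- Every section of the smocking map is Borel: only countably many of its values are not
forced. -/
theorem measurable_of_proj_section (P : SmockingPattern N)
    {s : P.Space → EuclideanSpace ℝ (Fin N)} (hs : ∀ x, P.proj (s x) = x) : Measurable s := by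
  intro U hU
  -- Off the smocking set `π` is injective, so Lusin–Souslin makes the image Borel; the rest is a
  -- subset of a countable set.
  have e : s ⁻¹' U = P.proj '' (U ∩ P.smockingSetᶜ) ∪
      (s ⁻¹' U ∩ P.proj '' P.smockingSet) := by
    ext x
    constructor
    · intro hx
      by_cases h : s x ∈ P.smockingSet
      · exact Or.inr ⟨hx, s x, h, hs x⟩
      · exact Or.inl ⟨s x, ⟨hx, h⟩, hs x⟩
    · rintro (⟨v, ⟨hv, hvS⟩, rfl⟩ | ⟨hx, -⟩)
      · have : v = s (P.proj v) := by
          rcases P.proj_eq_iff.1 (hs (P.proj v)).symm with h | ⟨I, hI, h1, -⟩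
          · exact h
          · exact (hvS ⟨I, hI, h1⟩).elim
        rw [Set.mem_preimage, ← this]
        exact hv
      · exact hx
  rw [e]
  refine MeasurableSet.union ?_
    (P.countable_image_smockingSet.mono Set.inter_subset_right).measurableSet
  exact (hU.inter P.measurableSet_smockingSet.compl).image_of_continuousOn_injOn
    P.continuous_proj.continuousOn (P.injOn_proj_compl.mono Set.inter_subset_right)

theorem exists_measurable_section (P : SmockingPattern N) :
    ∃ s : P.Space → EuclideanSpace ℝ (Fin N), Measurable s ∧ (∀ x, P.proj (s x) = x) ∧
      s P.basePoint = 0 := by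
  classical
  choose s hs using P.exists_rep
  -- Prescribing the value `0` at the base point is what makes the approximations preserve base
  -- points.
  have h : ∀ x, P.proj (Function.update s P.basePoint 0 x) = x := by
    intro x
    by_cases hx : x = P.basePoint
    · subst hx; simp [basePoint]
    · simpa [Function.update_of_ne hx] using hs x
  exact ⟨_, P.measurable_of_proj_section h, h, by simp⟩

/-! ### The hypotheses of the convergence theorem -/

theorem _root_.LocalUniformBounds.eventuallyBounded {P : ℕ → SmockingPattern N}
    (h : LocalUniformBounds P) : EventuallyBounded P := by
  intro R
  obtain ⟨L, _, _, K, hK⟩ := h (max R 1) (by positivity)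
  refine ⟨max R 1 + L, ?_⟩
  filter_upwards [eventually_ge_atTop K] with k hk I hI z hz
  obtain ⟨hI, y, hy, hyR⟩ := hI
  have hyR : ‖y‖ ≤ max R 1 := le_max_of_le_left (by simpa using hyR)
  have h1 := (hK k hk).1 I (mem_stitchesMeeting_of_norm_le hI hy hyR)
  have h2 := Metric.dist_le_diam_of_mem (((P k).isCompact I hI).isBounded) hy hz
  simpa using norm_le_of_dist_le hyR (h2.trans h1)

theorem _root_.LocalUniformBounds.locallySeparated {P : ℕ → SmockingPattern N}
    (h : LocalUniformBounds P) : LocallySeparated P := by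
  intro R
  obtain ⟨_, δ, hδ, K, hK⟩ := h (max R 1) (by positivity)
  refine ⟨δ, hδ, ?_⟩
  have hmono : ∀ k, (P k).stitchesMeeting R ⊆ (P k).stitchesMeeting (max R 1) := fun k I hI =>
    ⟨hI.1, hI.2.mono (Set.inter_subset_inter_right I
      (Metric.closedBall_subset_closedBall (le_max_left _ _)))⟩
  filter_upwards [eventually_ge_atTop K] with k hk I hI I' hI'
  exact (hK k hk).2 I (hmono k hI) I' (hmono k hI')

/-- The sets `S` and `T` are left free to cover both modes of convergence: whole smocking sets, or
unions of stitches meeting a ball. -/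
theorem pointsNear_of_tendsto {A B : ℕ → SmockingPattern N}
    (S T : ℝ → ℕ → Set (EuclideanSpace ℝ (Fin N)))
    (hS : ∀ R k, (A k).smockingSet ∩ Metric.closedBall 0 R ⊆ S R k)
    (hT : ∀ R k, T R k ⊆ (B k).smockingSet)
    (h : ∀ R, 0 < R → Tendsto (fun k => Metric.hausdorffEDist (S R k) (T R k)) atTop (𝓝 0)) :
    PointsNear A B := by
  intro R ε hε
  filter_upwards [(h (max R 1) (by positivity)).eventually_lt_const (ENNReal.ofReal_pos.2 hε)]
    with k hk z hz hzR
  obtain ⟨z', hz', hd⟩ := Metric.exists_edist_lt_of_hausdorffEDist_lt (hS (max R 1) k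
    ⟨hz, Metric.closedBall_subset_closedBall (le_max_left _ _) hzR⟩) hk
  exact ⟨z', hT _ k hz', edist_lt_ofReal.1 hd⟩

theorem pointsNear_of_hausdorffTendsto {P : ℕ → SmockingPattern N} {Q : SmockingPattern N}
    (h : HausdorffTendsto P Q ∨ LocallyHausdorffTendsto P Q) :
    PointsNear P (fun _ => Q) ∧ PointsNear (fun _ => Q) P := by
  have hin : ∀ (A : SmockingPattern N) (R : ℝ),
      A.smockingSet ∩ Metric.closedBall 0 R ⊆ ⋃₀ A.stitchesMeeting R := by
    rintro A R z ⟨⟨I, hI, hz⟩, hzR⟩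
    exact ⟨I, ⟨hI, z, hz, hzR⟩, hz⟩
  have hout : ∀ (A : SmockingPattern N) (R : ℝ), ⋃₀ A.stitchesMeeting R ⊆ A.smockingSet :=
    fun A R => Set.sUnion_subset_sUnion fun _ hI => hI.1
  rcases h with h | h
  · constructor
    · exact pointsNear_of_tendsto (fun _ k => (P k).smockingSet) (fun _ _ => Q.smockingSet)
        (fun _ _ => Set.inter_subset_left) (fun _ _ => subset_rfl) (fun _ _ => h)
    · refine pointsNear_of_tendsto (fun _ _ => Q.smockingSet) (fun _ k => (P k).smockingSet)
        (fun _ _ => Set.inter_subset_left) (fun _ _ => subset_rfl) (fun _ _ => ?_)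
      simpa only [HausdorffTendsto, Metric.hausdorffEDist_comm] using h
  · constructor
    · exact pointsNear_of_tendsto (fun R k => ⋃₀ (P k).stitchesMeeting R)
        (fun R _ => ⋃₀ Q.stitchesMeeting R) (fun R k => hin _ R) (fun R k => hout _ R) h
    · refine pointsNear_of_tendsto (fun R _ => ⋃₀ Q.stitchesMeeting R)
        (fun R k => ⋃₀ (P k).stitchesMeeting R) (fun R k => hin _ R) (fun R k => hout _ R) ?_
      intro R hR
      simpa only [Metric.hausdorffEDist_comm] using h R hR

end SmockingPattern

/-! ### Diagonal choice of indices -/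

/-- A diagonal sequence: countably many eventual properties, the first of which always holds,
are realised along a sequence of indices that tends to infinity. -/
theorem exists_tendsto_atTop_forall {p : ℕ → ℕ → Prop} (h0 : ∀ k, p 0 k)
    (h : ∀ n, ∀ᶠ k in atTop, p n k) : ∃ φ : ℕ → ℕ, Tendsto φ atTop atTop ∧ ∀ k, p (φ k) k := by
  classical
  choose K hK using fun n => eventually_atTop.1 (h n)
  -- The largest `n ≤ k` whose threshold `K n` has been passed; `n = 0` is always admissible as a
  -- default.
  refine ⟨fun k => Nat.findGreatest (fun n => n = 0 ∨ K n ≤ k) k, ?_, fun k => ?_⟩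
  · refine tendsto_atTop.2 fun n => ?_
    filter_upwards [eventually_ge_atTop (max n (K n))] with k hk
    exact Nat.le_findGreatest ((le_max_left _ _).trans hk) (Or.inr ((le_max_right _ _).trans hk))
  · rcases Nat.findGreatest_spec (P := fun n => n = 0 ∨ K n ≤ k) (Nat.zero_le k) (Or.inl rfl)
      with h1 | h1
    · simp only [h1, h0]
    · exact hK _ k h1

/-! ### Integrals, distortion and density for maps induced by sections -/

namespace SmockingPattern

variable {N : ℕ}

theorem setIntegral_ball_measure (P : SmockingPattern N) (r : ℝ) {g : P.Space → ℝ}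
    (hg : Measurable g) :
    ∫ a in Metric.ball P.basePoint r, g a ∂P.measure =
      ∫ v, (Metric.ball P.basePoint r).indicator g (P.proj v) := by
  have hball : MeasurableSet (Metric.ball P.basePoint r) := Metric.isOpen_ball.measurableSet
  rw [← integral_indicator hball, measure, integral_map P.measurable_proj.aemeasurable
    (hg.indicator hball).aestronglyMeasurable]

/-- Convergence of the integrals of test functions, for approximations that are induced by
sections `s k` of the smocking maps. -/
theorem tendsto_setIntegral_ball {P : ℕ → SmockingPattern N} {Q : SmockingPattern N}
    {s : ∀ k, (P k).Space → EuclideanSpace ℝ (Fin N)} (hsm : ∀ k, Measurable (s k))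
    (hs : ∀ k x, (P k).proj (s k x) = x) (hs0 : ∀ k, s k (P k).basePoint = 0)
    (hlift : ∀ r : ℝ, ∃ R' : ℝ, ∀ᶠ k in atTop, ∀ w,
      dist ((P k).proj w) (P k).basePoint < r → ‖w‖ ≤ R')
    (hdist : ∀ R η : ℝ, 0 < η → ∀ᶠ k in atTop, ∀ v w, ‖v‖ ≤ R → ‖w‖ ≤ R →
      dist (Q.proj v) (Q.proj w) ≤ dist ((P k).proj v) ((P k).proj w) + η)
    {R ε : ℕ → ℝ} (hR : Tendsto R atTop atTop) (hε : ∀ᶠ k in atTop, ε k ≤ 1)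
    (hdistort : ∀ k, ∀ a ∈ Metric.ball (P k).basePoint (R k),
      ∀ b ∈ Metric.ball (P k).basePoint (R k),
        |dist (Q.proj (s k a)) (Q.proj (s k b)) - dist a b| ≤ ε k)
    {φ : Q.Space → ℝ} (hφ : Continuous φ) (hφb : ∃ C, ∀ p, |φ p| ≤ C)
    (hφs : Bornology.IsBounded (Function.support φ)) :
    Tendsto (fun k => ∫ a in Metric.ball (P k).basePoint (R k), φ (Q.proj (s k a)) ∂(P k).measure)
      atTop (𝓝 (∫ p, φ p ∂Q.measure)) := by
  obtain ⟨C, hC⟩ := hφb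
  obtain ⟨r, hr⟩ := hφs.subset_ball Q.basePoint
  obtain ⟨R', hR'⟩ := hlift (r + 1)
  have hgm : ∀ k, Measurable fun a => φ (Q.proj (s k a)) := fun k =>
    hφ.measurable.comp (Q.measurable_proj.comp (hsm k))
  simp_rw [fun k => (P k).setIntegral_ball_measure (R k) (hgm k)]
  rw [measure, integral_map Q.measurable_proj.aemeasurable hφ.measurable.aestronglyMeasurable]
  refine tendsto_integral_filter_of_dominated_convergence
    ((Metric.closedBall (0 : EuclideanSpace ℝ (Fin N)) R').indicator fun _ => C) ?_ ?_ ?_ ?_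
  · exact Eventually.of_forall fun k => (((hgm k).indicator
      Metric.isOpen_ball.measurableSet).comp (P k).measurable_proj).aestronglyMeasurable
  · filter_upwards [hR', hε, hR.eventually_gt_atTop 0] with k hR' hε hR0
    refine Eventually.of_forall fun v => ?_
    have hC0 : 0 ≤ C := (abs_nonneg _).trans (hC Q.basePoint)
    by_cases hv : (P k).proj v ∈ Metric.ball (P k).basePoint (R k)
    · rw [Set.indicator_of_mem hv]
      by_cases h0 : φ (Q.proj (s k ((P k).proj v))) = 0
      · rw [h0, norm_zero]
        exact Set.indicator_nonneg (fun _ _ => hC0) v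
      -- Where the integrand is nonzero, the image lies within `r` of the base point. Distortion at
      -- most `1` puts `π_k v` within `r + 1`, hence `v` in the ball of radius `R'`.
      · have h1 := Metric.mem_ball.1 (hr (Function.mem_support.2 h0))
        have h2 := hdistort k _ hv _ (Metric.mem_ball_self hR0)
        rw [hs0] at h2
        change |dist _ Q.basePoint - _| ≤ _ at h2
        have h3 := hR' v (by linarith [(abs_le.1 h2).1])
        rw [Set.indicator_of_mem (by simpa using h3)]
        exact hC _
    · rw [Set.indicator_of_notMem hv, norm_zero]
      exact Set.indicator_nonneg (fun _ _ => hC0) v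
  · exact (integrable_indicator_iff Metric.isClosed_closedBall.measurableSet).2
      (integrableOn_const measure_closedBall_lt_top.ne)
  · refine Eventually.of_forall fun v => ?_
    obtain ⟨R₁, hR₁⟩ := hlift (‖v‖ + 1)
    have hbase : ∀ k, dist ((P k).proj v) (P k).basePoint ≤ ‖v‖ := fun k =>
      ((P k).dist_proj_le v 0).trans (by simp)
    -- The points `s_k (π_k v)` need not approach `v`, but both have the same image in `X_k`, so
    -- their images in the limit space become close.
    have hconv : Tendsto (fun k => Q.proj (s k ((P k).proj v))) atTop (𝓝 (Q.proj v)) := by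
      refine Metric.tendsto_nhds.2 fun η hη => ?_
      filter_upwards [hR₁, hdist R₁ (η / 2) (by positivity)] with k hR₁ hdist
      have h1 := hdist (s k ((P k).proj v)) v
        (hR₁ _ (by rw [hs]; linarith [hbase k])) (hR₁ v (by linarith [hbase k]))
      rw [hs, dist_self] at h1
      linarith
    refine ((hφ.tendsto _).comp hconv).congr' ?_
    filter_upwards [hR.eventually_gt_atTop ‖v‖] with k hk
    have hv : (P k).proj v ∈ Metric.ball (P k).basePoint (R k) := (hbase k).trans_lt hk
    rw [Set.indicator_of_mem hv, Function.comp_apply]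

/-- On balls of a fixed radius, the maps induced by sections of the smocking maps are eventually
almost isometries with almost dense image. -/
theorem eventually_distortion_and_density {P : ℕ → SmockingPattern N} {Q : SmockingPattern N}
    {s : ∀ k, (P k).Space → EuclideanSpace ℝ (Fin N)} (hs : ∀ k x, (P k).proj (s k x) = x)
    (hlift : ∀ r : ℝ, ∃ R' : ℝ, ∀ᶠ k in atTop, ∀ w,
      dist ((P k).proj w) (P k).basePoint < r → ‖w‖ ≤ R')
    (hliftQ : ∀ r : ℝ, ∃ R' : ℝ, ∀ w, dist (Q.proj w) Q.basePoint < r → ‖w‖ ≤ R')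
    (hPQ : ∀ R η : ℝ, 0 < η → ∀ᶠ k in atTop, ∀ v w, ‖v‖ ≤ R → ‖w‖ ≤ R →
      dist (Q.proj v) (Q.proj w) ≤ dist ((P k).proj v) ((P k).proj w) + η)
    (hQP : ∀ R η : ℝ, 0 < η → ∀ᶠ k in atTop, ∀ v w, ‖v‖ ≤ R → ‖w‖ ≤ R →
      dist ((P k).proj v) ((P k).proj w) ≤ dist (Q.proj v) (Q.proj w) + η)
    (r : ℝ) {ε : ℝ} (hε : 0 < ε) :
    ∀ᶠ k in atTop,
      (∀ a ∈ Metric.ball (P k).basePoint r, ∀ b ∈ Metric.ball (P k).basePoint r,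
        |dist (Q.proj (s k a)) (Q.proj (s k b)) - dist a b| ≤ ε) ∧
      Metric.ball Q.basePoint (r - ε) ⊆ Metric.thickening ε
        ((fun a => Q.proj (s k a)) '' Metric.ball (P k).basePoint r) := by
  obtain ⟨R₁, hR₁⟩ := hlift r
  obtain ⟨R₂, hR₂⟩ := hliftQ (r - ε)
  set R := max 0 (max R₁ R₂)
  have h1R : R₁ ≤ R := (le_max_left _ _).trans (le_max_right _ _)
  have h2R : R₂ ≤ R := (le_max_right _ _).trans (le_max_right _ _)
  have h0R : ‖(0 : EuclideanSpace ℝ (Fin N))‖ ≤ R := by simp [R]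
  filter_upwards [hR₁, hPQ R (ε / 2) (by positivity), hQP R (ε / 2) (by positivity)] with
    k hR₁ hPQ hQP
  have hsR : ∀ a ∈ Metric.ball (P k).basePoint r, ‖s k a‖ ≤ R := fun a ha =>
    (hR₁ _ (by rw [hs]; exact ha)).trans h1R
  constructor
  · intro a ha b hb
    have h1 := hPQ _ _ (hsR a ha) (hsR b hb)
    have h2 := hQP _ _ (hsR a ha) (hsR b hb)
    rw [hs, hs] at h1 h2
    exact abs_le.2 ⟨by linarith, by linarith⟩
  · intro y hy
    obtain ⟨v, rfl⟩ := Q.exists_rep y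
    have hvR : ‖v‖ ≤ R := (hR₂ v hy).trans h2R
    have hv : (P k).proj v ∈ Metric.ball (P k).basePoint r := by
      have h1 : dist ((P k).proj v) (P k).basePoint ≤ dist (Q.proj v) Q.basePoint + ε / 2 :=
        hQP v 0 hvR h0R
      rw [Metric.mem_ball] at hy ⊢
      linarith
    refine Metric.mem_thickening_iff.2 ⟨_, ⟨_, hv, rfl⟩, ?_⟩
    have h1 := hPQ v _ hvR (hsR _ hv)
    rw [hs, dist_self] at h1
    linarith

end SmockingPattern

/-! ### Assembly -/

open SmockingPattern in
theorem mainTheorem6 {N : ℕ} (P : ℕ → SmockingPattern N) (Q : SmockingPattern N)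
    (hconv : HausdorffTendsto P Q ∨ LocallyHausdorffTendsto P Q)
    (hbound : LocalUniformBounds P) :
    PointedMeasuredGHTendsto (fun k => (P k).measure) (fun k => (P k).basePoint)
      Q.measure Q.basePoint := by
  obtain ⟨hPQ, hQP⟩ := pointsNear_of_hausdorffTendsto hconv
  obtain ⟨δ, hδ, hQs⟩ := Q.exists_eventuallySeparated_const
  have hQb := Q.eventuallyBounded_const
  have hPb := hbound.eventuallyBounded
  have hPQ := hPQ.stitchesNear hPb (hQs.locallySeparated hδ)
  have hQP := hQP.stitchesNear hQb hbound.locallySeparated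
  have hPs := hbound.locallySeparated.eventuallySeparated hPQ hQP hPb hδ hQs
  have hlift := exists_norm_le_of_dist_lt hPb (half_pos hδ) hPs
  have hliftQ := fun r =>
    (exists_norm_le_of_dist_lt hQb hδ hQs r).imp fun _ h => h.exists.choose_spec
  have hd₁ := fun R η (hη : 0 < η) => hPQ.dist_proj_le_add hPb (half_pos hδ) hPs R hη
  have hd₂ := fun R η (hη : 0 < η) => hQP.dist_proj_le_add hQb hδ hQs R hη
  choose s hsm hs hs0 using fun k => (P k).exists_measurable_section
  obtain ⟨n, hn, hp⟩ := exists_tendsto_atTop_forall (p := fun n k =>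
      (∀ a ∈ Metric.ball (P k).basePoint (n : ℝ), ∀ b ∈ Metric.ball (P k).basePoint (n : ℝ),
        |dist (Q.proj (s k a)) (Q.proj (s k b)) - dist a b| ≤ 1 / ((n : ℝ) + 1)) ∧
      Metric.ball Q.basePoint ((n : ℝ) - 1 / ((n : ℝ) + 1)) ⊆
        Metric.thickening (1 / ((n : ℝ) + 1))
          ((fun a => Q.proj (s k a)) '' Metric.ball (P k).basePoint (n : ℝ)))
    -- At `n = 0` the radius is `0` and the error `1`, so both balls are empty.
    (fun k => by
      constructor
      · simp
      · rw [Metric.ball_eq_empty.2 (by simp)]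
        exact Set.empty_subset _)
    (fun n => eventually_distortion_and_density hs hlift hliftQ hd₁ hd₂ n (by positivity))
  have hR : Tendsto (fun k => (n k : ℝ)) atTop atTop := tendsto_natCast_atTop_atTop.comp hn
  have hε : Tendsto (fun k => 1 / ((n k : ℝ) + 1)) atTop (𝓝 0) :=
    tendsto_one_div_add_atTop_nhds_zero_nat.comp hn
  refine ⟨fun k r => (P k).measure_ball_lt_top r, Q.measure_ball_lt_top,
    fun k => n k, fun k => 1 / ((n k : ℝ) + 1), fun k a => Q.proj (s k a), hR,
    fun k => by positivity, hε, fun k => Q.measurable_proj.comp (hsm k), fun k => ?_,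
    fun k => (hp k).1, fun k => (hp k).2, fun φ hφ hφb hφs => ?_⟩
  · change Q.proj (s k (P k).basePoint) = Q.basePoint
    rw [hs0]; rfl
  · exact tendsto_setIntegral_ball hsm hs hs0 hlift hd₁ hR (hε.eventually_le_const one_pos)
      (fun k => (hp k).1) hφ hφb hφs
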